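/- Let $n\ge 0$ be an integer, let $F:\mathbb R^n\times\mathbb R_{\ge 0}\to 2^{\mathbb R^n}$ be a set-valued map, and consider the differential inclusion $\dot x\in F(x,t)$. (This covers the Filippov inclusion of $\dot x=f(x,t)$, where $F(x,t)=\bigcap_{\delta>0}\bigcap_{\mu(S)=0}\overline{\operatorname{co}}\,\{f(\tilde x,t):\|\tilde x-x\|<\delta,\ \tilde x\notin S\}$; its solutions are then called Filippov solutions.) Definitions. An interval is a connected subset of $\mathbb R$ of nonzero Lebesgue measure. A function $g$ is $AC_*$ on a set $S\subseteq\mathbb R$ if for each $\varepsilon>0$ there is $\delta>0$ such that $\sum_{i=1}^m\sup_{a,b\in[a_i,b_i]}\|g(b)-g(a)\|<\varepsilon$ for every finite collection of non-overlapping intervals $[a_i,b_i]$ with $a_i,b_i\in S$ and $\sum_{i=1}^m(b_i-a_i)<\delta$; it is $ACG_*$ on $S$ if $g|_S$ is continuous and $S$ is a countable union of sets on each of which $g$ is $AC_*$. Let $I\subseteq\mathbb R_{\ge 0}$ be an interval. A function $x:I\to\mathbb R^n$ is a classical (respectively generalized) solution if it is absolutely continuous on every compact subinterval of $I$ (respectively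 $ACG_*$ on $I$) and, for almost every $t\in I$, is differentiable at $t$ with $\dot x(t)\in F(x(t),t)$. A classical (generalized) solution $x:I\to\mathbb R^n$ is maximal if there is no classical (generalized) solution $\bar x:\bar I\to\mathbb R^n$ with $\bar I\cap I\ne\emptyset$, $\sup\bar I>\sup I$ and $\bar x=x$ on $I\cap\bar I$. The origin is an attractive equilibrium in the classical (generalized) sense if $0\in F(0,t)$ for almost all $t\ge 0$ and every maximal classical (generalized) solution $x:I\to\mathbb R^n$ satisfies $\lim_{t\to\sup I}x(t)=0$, where $\sup I\in(0,\infty]$. Theorem. Let $D\subseteq\mathbb R_{\ge 0}$ have no cluster points in $\mathbb R$, and suppose that $F$ is locally bounded on $E=\mathbb R^n\times(\mathbb R_{\ge 0}\setminus D)$, i.e. every point of $E$ has a neighborhood $U$ in $E$ such that $\bigcup_{(y,s)\in U}F(y,s)$ is bounded. Suppose that the origin is an attractive equilibrium in the classical sense. Then every maximal generalized solution $x:I\to\mathbb R^n$ satisfies $\sup I=\infty$. If, moreover, $D$ is bounded above, then the origin is an attractive equilibrium in the generalized sense. -/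

import Mathlib

open MeasureTheory Filter Topology Set

/-- A function `g` is absolutely continuous in the restricted sense (`AC*`) on `S ⊆ ℝ`: the
oscillations of `g` over finitely many non-overlapping intervals `[a i, b i]` with endpoints
in `S` and small total length have a small sum. The supremum of `‖g d - g c‖` over
`c, d ∈ [a i, b i]` is the diameter of the image of `[a i, b i]`, taken in `[0, ∞]`; for
`a i ≤ b i`, non-overlapping is the same as disjointness of the half-open intervals. -/
def ACStarOn {n : ℕ} (g : ℝ → EuclideanSpace ℝ (Fin n)) (S : Set ℝ) : Prop :=
  ∀ ε : ℝ, 0 < ε → ∃ δ : ℝ, 0 < δ ∧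
    ∀ (m : ℕ) (a b : Fin m → ℝ),
      (∀ i, a i ≤ b i ∧ a i ∈ S ∧ b i ∈ S) →
      Pairwise (fun i j => Disjoint (Ioc (a i) (b i)) (Ioc (a j) (b j))) →
      ∑ i, (b i - a i) < δ →
      ∑ i, Metric.ediam (g '' Icc (a i) (b i)) < ENNReal.ofReal ε

/-- A function `g` is generalized absolutely continuous in the restricted sense (`ACG*`)
on `S`. -/
def ACGStarOn {n : ℕ} (g : ℝ → EuclideanSpace ℝ (Fin n)) (S : Set ℝ) : Prop :=
  ContinuousOn g S ∧ ∃ C : ℕ → Set ℝ, S = ⋃ k, C k ∧ ∀ k, ACStarOn g (C k)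

/-- Local absolute continuity on `I`: absolute continuity on each compact interval in `I`. -/
def LocallyACOn {n : ℕ} (g : ℝ → EuclideanSpace ℝ (Fin n)) (I : Set ℝ) : Prop :=
  ∀ a b : ℝ, a ≤ b → Icc a b ⊆ I → AbsolutelyContinuousOnInterval g a b

/-- An interval of nonnegative times: a connected subset of `[0, ∞)` of nonzero measure. -/
def IsTimeInterval (I : Set ℝ) : Prop :=
  I ⊆ Ici 0 ∧ IsConnected I ∧ volume I ≠ 0

/-- `x` is differentiable with `x' (t) ∈ F (x t) t` at almost every time `t ∈ I`. -/
def SatisfiesInclusionAE {n : ℕ}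
    (F : EuclideanSpace ℝ (Fin n) → ℝ → Set (EuclideanSpace ℝ (Fin n)))
    (I : Set ℝ) (x : ℝ → EuclideanSpace ℝ (Fin n)) : Prop :=
  ∀ᵐ t : ℝ, t ∈ I → ∃ v ∈ F (x t) t, HasDerivAt x v t

/-- Classical solutions on `I` of the inclusion `x' ∈ F (x, t)`. A function on `I` is represented
by a function on `ℝ` whose values outside `I` play no role; likewise only the values of `F` at
times `t ≥ 0` play a role. -/
def IsClassicalSolution {n : ℕ}
    (F : EuclideanSpace ℝ (Fin n) → ℝ → Set (EuclideanSpace ℝ (Fin n)))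
    (I : Set ℝ) (x : ℝ → EuclideanSpace ℝ (Fin n)) : Prop :=
  IsTimeInterval I ∧ LocallyACOn x I ∧ SatisfiesInclusionAE F I x

/-- Generalized solutions on `I` of the inclusion `x' ∈ F (x, t)`. -/
def IsGeneralizedSolution {n : ℕ}
    (F : EuclideanSpace ℝ (Fin n) → ℝ → Set (EuclideanSpace ℝ (Fin n)))
    (I : Set ℝ) (x : ℝ → EuclideanSpace ℝ (Fin n)) : Prop :=
  IsTimeInterval I ∧ ACGStarOn x I ∧ SatisfiesInclusionAE F I x

/-- The supremum of a set of times, possibly `+∞`. -/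
noncomputable def supTime (I : Set ℝ) : EReal := sSup (Real.toEReal '' I)

/-- Maximality of a solution `x` on `I` among the solutions of the kind `Sol` (classical or
generalized): no solution that agrees with `x` on the nonempty common part of their domains
reaches beyond `sup I`. -/
def IsMaximalSolution {n : ℕ} (Sol : Set ℝ → (ℝ → EuclideanSpace ℝ (Fin n)) → Prop)
    (I : Set ℝ) (x : ℝ → EuclideanSpace ℝ (Fin n)) : Prop :=
  Sol I x ∧ ¬ ∃ (J : Set ℝ) (y : ℝ → EuclideanSpace ℝ (Fin n)),
    Sol J y ∧ (J ∩ I).Nonempty ∧ supTime I < supTime J ∧ ∀ t ∈ I ∩ J, x t = y t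

/-- The origin is an attractive equilibrium of `x' ∈ F (x, t)` with respect to the solutions of
the kind `Sol`: `0 ∈ F (0, t)` for almost all `t ≥ 0`, and every maximal solution `x` on `I`
tends to `0` as `t → sup I` within `I`, where `sup I` may be `+∞`. -/
def IsAttractiveEquilibrium {n : ℕ}
    (F : EuclideanSpace ℝ (Fin n) → ℝ → Set (EuclideanSpace ℝ (Fin n)))
    (Sol : Set ℝ → (ℝ → EuclideanSpace ℝ (Fin n)) → Prop) : Prop :=
  (∀ᵐ t : ℝ, 0 ≤ t → (0 : EuclideanSpace ℝ (Fin n)) ∈ F 0 t) ∧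
  ∀ (I : Set ℝ) (x : ℝ → EuclideanSpace ℝ (Fin n)), IsMaximalSolution Sol I x →
    Tendsto x (comap Real.toEReal (𝓝 (supTime I)) ⊓ 𝓟 I) (𝓝 0)

/-- The origin is an attractive equilibrium in the classical sense. -/
def IsClassicallyAttractive {n : ℕ}
    (F : EuclideanSpace ℝ (Fin n) → ℝ → Set (EuclideanSpace ℝ (Fin n))) : Prop :=
  IsAttractiveEquilibrium F (IsClassicalSolution F)

/-- The origin is an attractive equilibrium in the generalized sense. -/
def IsGeneralizedAttractive {n : ℕ}
    (F : EuclideanSpace ℝ (Fin n) → ℝ → Set (EuclideanSpace ℝ (Fin n))) : Prop :=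
  IsAttractiveEquilibrium F (IsGeneralizedSolution F)

/-- `F` is locally bounded on `ℝⁿ × ([0, ∞) \ D)`: every point of this set has a neighbourhood
in it over which all the values of `F` lie in one ball. -/
def LocallyBoundedOff {n : ℕ}
    (F : EuclideanSpace ℝ (Fin n) → ℝ → Set (EuclideanSpace ℝ (Fin n)))
    (D : Set ℝ) : Prop :=
  ∀ (x : EuclideanSpace ℝ (Fin n)) (t : ℝ), t ∈ Ici 0 \ D →
    ∃ Q : ℝ, ∀ᶠ p : EuclideanSpace ℝ (Fin n) × ℝ in 𝓝[univ ×ˢ (Ici 0 \ D)] (x, t),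
      ∀ v ∈ F p.1 p.2, ‖v‖ ≤ Q

/-!
An `ACG*` function maps null sets to null sets, and so does its composition with a linear
functional. A continuous real function `f` with this property and with `|f'| ≤ K` almost everywhere
is `K`-Lipschitz: `|f b - f a|` is at most the measure of the image of `[a, b]`, hence at most
`∫ |f'|`. Taking for `f` the inner product of a generalized solution `x` with `x a - x b` shows that
`x` is locally Lipschitz, hence classical, on intervals that avoid `D`.

If the domain of a maximal generalized solution had a finite supremum `T`, the solution would thus
be classical on some `[p, T)`. Either it has a classical extension beyond `T`, or it is maximal and
tends to `0` at `T`, so that it can be continued by the zero solution; both contradict maximality.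
-/

section Measure

open scoped ENNReal NNReal

lemma sum_iSup_eq_iSup_sum_pi {ι : Type*} {κ : ι → Type*} [∀ i, Nonempty (κ i)] (s : Finset ι)
    (f : ∀ i, κ i → ℝ≥0∞) : ∑ i ∈ s, ⨆ j, f i j = ⨆ c : ∀ i, κ i, ∑ i ∈ s, f i (c i) := by
  classical
  rw [← ENNReal.finsetSum_iSup fun c d =>
    ⟨fun i => if f i (c i) ≤ f i (d i) then d i else c i, fun i => by grind⟩]
  exact Finset.sum_congr rfl fun i _ => ((Function.surjective_eval i).iSup_comp (f i)).symm

lemma sum_ediam_image_le {ι α X : Type*} [PseudoEMetricSpace X] {g : α → X} {A : ι → Set α}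
    {s : Finset ι} {C : ℝ≥0∞} (hA : ∀ i, (A i).Nonempty)
    (h : ∀ p q : ι → α, (∀ i, p i ∈ A i) → (∀ i, q i ∈ A i) →
      ∑ i ∈ s, edist (g (p i)) (g (q i)) ≤ C) :
    ∑ i ∈ s, Metric.ediam (g '' A i) ≤ C := by
  have (i : ι) : Nonempty (A i) := (hA i).to_subtype
  calc ∑ i ∈ s, Metric.ediam (g '' A i)
      ≤ ∑ i ∈ s, ⨆ z : A i × A i, edist (g z.1) (g z.2) :=
        Finset.sum_le_sum fun i _ => Metric.ediam_image_le_iff.2 fun x hx y hy =>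
          le_iSup (fun z : A i × A i => edist (g z.1) (g z.2)) (⟨x, hx⟩, ⟨y, hy⟩)
    _ = ⨆ c : ∀ i, A i × A i, ∑ i ∈ s, edist (g (c i).1) (g (c i).2) :=
        sum_iSup_eq_iSup_sum_pi s fun i (z : A i × A i) => edist (g z.1) (g z.2)
    _ ≤ C := iSup_le fun c => h _ _ (fun i => (c i).1.2) fun i => (c i).2.2

lemma exists_countable_pairwiseDisjoint_isConnected_sUnion_eq {X : Type*} [TopologicalSpace X]
    [LocallyConnectedSpace X] [TopologicalSpace.SeparableSpace X] {U : Set X} (hU : IsOpen U) :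
    ∃ 𝒞 : Set (Set X), 𝒞.Countable ∧ 𝒞.PairwiseDisjoint id ∧
      (∀ c ∈ 𝒞, IsOpen c ∧ IsConnected c) ∧ ⋃₀ 𝒞 = U := by
  have hdisj : (connectedComponentIn U '' U).PairwiseDisjoint id := by
    rintro _ ⟨t, -, rfl⟩ _ ⟨s, -, rfl⟩ hts
    exact disjoint_left.2 fun u hut hus =>
      hts ((connectedComponentIn_eq hut).trans (connectedComponentIn_eq hus).symm)
  have hconn : ∀ c ∈ connectedComponentIn U '' U, IsOpen c ∧ IsConnected c := by
    rintro _ ⟨t, ht, rfl⟩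
    exact ⟨hU.connectedComponentIn, isConnected_connectedComponentIn_iff.2 ht⟩
  refine ⟨_, hdisj.countable_of_isOpen (fun c hc => (hconn c hc).1)
    fun c hc => (hconn c hc).2.nonempty, hdisj, hconn, Subset.antisymm ?_ ?_⟩
  · rintro _ ⟨_, ⟨t, -, rfl⟩, ht⟩
    exact connectedComponentIn_subset U t ht
  · exact fun t ht => ⟨_, mem_image_of_mem _ ht, mem_connectedComponentIn ht⟩

/-- Lusin's condition (N) on `S`: the function maps null subsets of `S` to null sets. -/
def LusinN (f : ℝ → ℝ) (S : Set ℝ) : Prop :=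
  ∀ ⦃Z⦄, Z ⊆ S → volume Z = 0 → volume (f '' Z) = 0

namespace LusinN

variable {f : ℝ → ℝ} {S : Set ℝ}

lemma iUnion {ι : Type*} [Countable ι] {C : ι → Set ℝ} (h : ∀ k, LusinN f (C k)) :
    LusinN f (⋃ k, C k) := by
  intro Z hZ hZ0
  rw [← inter_eq_right.2 hZ, iUnion_inter, image_iUnion]
  exact measure_iUnion_null fun k =>
    h k inter_subset_left (measure_mono_null inter_subset_right hZ0)

lemma volume_image_le {K : ℝ≥0} (hN : LusinN f S) (hS : MeasurableSet S)
    (hd : ∀ᵐ t : ℝ, t ∈ S → ∃ v, ‖v‖ ≤ K ∧ HasDerivAt f v t) :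
    volume (f '' S) ≤ K * volume S := by
  obtain ⟨Z, hbad, hZ, hZ0⟩ := exists_measurable_superset_of_null (ae_iff.1 hd)
  have hder (t : ℝ) (ht : t ∈ S \ Z) : ∃ v, ‖v‖ ≤ K ∧ HasDerivAt f v t :=
    not_not.1 (fun h => ht.2 (hbad h)) ht.1
  have hgood : volume (f '' (S \ Z)) ≤ K * volume S := calc
    volume (f '' (S \ Z))
      ≤ ∫⁻ t in S \ Z, ENNReal.ofReal |(fderiv ℝ f t).det| :=
        addHaar_image_le_lintegral_abs_det_fderiv volume (hS.diff hZ) fun t ht =>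
          (hder t ht).choose_spec.2.differentiableAt.hasFDerivAt.hasFDerivWithinAt
    _ ≤ ∫⁻ _ in S \ Z, K := setLIntegral_mono measurable_const fun t ht => by
        obtain ⟨v, hv, hvt⟩ := hder t ht
        rw [hvt.hasFDerivAt.fderiv]
        simpa [ENNReal.ofReal_le_iff_le_toReal] using hv
    _ ≤ K * volume S := by
        rw [setLIntegral_const]
        gcongr
        exact sdiff_subset
  have hnull : volume (f '' (S ∩ Z)) = 0 :=
    hN inter_subset_left (measure_mono_null inter_subset_right hZ0)
  calc volume (f '' S)
      ≤ volume (f '' (S \ Z)) + volume (f '' (S ∩ Z)) := by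
        nth_rw 1 [← sdiff_union_inter S Z, image_union]
        exact measure_union_le _ _
    _ ≤ K * volume S := by rwa [hnull, add_zero]

theorem lipschitzOnWith {K : ℝ≥0} (hN : LusinN f S) (hS : S.OrdConnected) (hf : ContinuousOn f S)
    (hd : ∀ᵐ t : ℝ, t ∈ S → ∃ v, ‖v‖ ≤ K ∧ HasDerivAt f v t) : LipschitzOnWith K f S := by
  have volume_uIcc (u v : ℝ) : volume (uIcc u v) = edist u v := by
    rw [Real.volume_interval, edist_comm, edist_dist, Real.dist_eq]
  intro a ha b hb
  have hab : uIcc a b ⊆ S := hS.uIcc_subset ha hb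
  calc edist (f a) (f b)
      = volume (uIcc (f a) (f b)) := (volume_uIcc _ _).symm
    _ ≤ volume (f '' uIcc a b) := measure_mono (intermediate_value_uIcc (hf.mono hab))
    _ ≤ K * volume (uIcc a b) := volume_image_le (fun Z hZ => hN (hZ.trans hab)) measurableSet_uIcc
        (hd.mono fun t ht htab => ht (hab htab))
    _ = K * edist a b := by rw [volume_uIcc]

end LusinN

end Measure

section ACStar

open scoped ENNReal NNReal

variable {n : ℕ} {g : ℝ → EuclideanSpace ℝ (Fin n)} {S : Set ℝ}

lemma ACStarOn.exists_sum_ediam_image_inter_le (hg : ACStarOn g S) {ε : ℝ} (hε : 0 < ε) :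
    ∃ δ : ℝ, 0 < δ ∧ ∀ {ι : Type*} (s : Finset ι) (c : ι → Set ℝ), (∀ i, (c i).OrdConnected) →
      (∀ i, (S ∩ c i).Nonempty) → (s : Set ι).PairwiseDisjoint c →
      ∑ i ∈ s, volume (c i) < ENNReal.ofReal δ →
      ∑ i ∈ s, Metric.ediam (g '' (S ∩ c i)) ≤ ENNReal.ofReal ε := by
  obtain ⟨δ, hδ, hgδ⟩ := hg ε hε
  refine ⟨δ, hδ, fun {ι} s c hconn hne hdisj hvol => sum_ediam_image_le hne fun p q hp hq => ?_⟩
  have hsub (i : ι) : Icc (p i ⊓ q i) (p i ⊔ q i) ⊆ c i := (hconn i).uIcc_subset (hp i).2 (hq i).2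
  have hlen : ∑ i ∈ s, (p i ⊔ q i - p i ⊓ q i) < δ := by
    rw [← ENNReal.ofReal_lt_ofReal_iff hδ,
      ENNReal.ofReal_sum_of_nonneg fun i _ => sub_nonneg.2 inf_le_sup]
    refine (Finset.sum_le_sum fun i _ => ?_).trans_lt hvol
    rw [← Real.volume_Icc]
    exact measure_mono (hsub i)
  let e := s.equivFin.symm
  have hsum {M : Type} [AddCommMonoid M] (f : ι → M) : ∑ k, f (e k) = ∑ i ∈ s, f i := by
    rw [e.sum_comp fun i => f i, Finset.sum_coe_sort]
  refine le_trans ?_ (hgδ s.card (fun k => p (e k) ⊓ q (e k)) (fun k => p (e k) ⊔ q (e k))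
    (fun k => ⟨inf_le_sup, ?_, ?_⟩) (fun k l hkl => ?_) ?_).le
  · rw [hsum fun i => Metric.ediam (g '' Icc (p i ⊓ q i) (p i ⊔ q i))]
    exact Finset.sum_le_sum fun i _ => Metric.edist_le_ediam_of_mem
      (mem_image_of_mem g left_mem_uIcc) (mem_image_of_mem g right_mem_uIcc)
  · exact inf_ind _ _ (hp _).1 (hq _).1
  · exact sup_ind _ _ (hp _).1 (hq _).1
  · exact (hdisj (e k).2 (e l).2 fun h => hkl (e.injective (Subtype.ext h))).mono
      (Ioc_subset_Icc_self.trans (hsub _)) (Ioc_subset_Icc_self.trans (hsub _))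
  · rwa [hsum fun i => p i ⊔ q i - p i ⊓ q i]

lemma ACStarOn.lusinN_comp {φ : EuclideanSpace ℝ (Fin n) → ℝ} {K : ℝ≥0} (hφ : LipschitzWith K φ)
    (hg : ACStarOn g S) : LusinN (φ ∘ g) S := by
  intro Z hZS hZ
  refine nonpos_iff_eq_zero.1 (ENNReal.le_of_forall_pos_le_add fun ε hε _ => ?_)
  obtain ⟨δ, hδ, hgδ⟩ := hg.exists_sum_ediam_image_inter_le (ε := ε / (K + 1)) (by positivity)
  obtain ⟨U, hZU, hU, hUδ⟩ := Z.exists_isOpen_lt_of_lt (ENNReal.ofReal δ) (hZ.trans_lt (by simpa))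
  obtain ⟨𝒞, h𝒞, hdisj, hconn, rfl⟩ := exists_countable_pairwiseDisjoint_isConnected_sUnion_eq hU
  let 𝒞' : Set (Set ℝ) := {c ∈ 𝒞 | (S ∩ c).Nonempty}
  have h𝒞' : 𝒞'.Countable := h𝒞.mono (sep_subset _ _)
  have hcover : φ ∘ g '' Z ⊆ ⋃ c ∈ 𝒞', φ '' (g '' (S ∩ c)) := by
    rintro _ ⟨t, ht, rfl⟩
    obtain ⟨c, hc, htc⟩ := hZU ht
    exact mem_biUnion (x := c) ⟨hc, t, hZS ht, htc⟩
      (mem_image_of_mem φ (mem_image_of_mem g ⟨hZS ht, htc⟩))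
  have hsmall (s : Finset 𝒞') : ∑ c ∈ s, Metric.ediam (g '' (S ∩ c)) ≤
      ENNReal.ofReal (ε / (K + 1)) := by
    have hsdisj : (s : Set 𝒞').PairwiseDisjoint fun c => (c : Set ℝ) := fun c _ d _ hcd =>
      hdisj c.2.1 d.2.1 (Subtype.coe_injective.ne hcd)
    refine hgδ s (↑) (fun c => (hconn c c.2.1).2.isPreconnected.ordConnected) (fun c => c.2.2)
      hsdisj (lt_of_le_of_lt ?_ hUδ)
    rw [← measure_biUnion_finset hsdisj fun c _ => (hconn c c.2.1).1.measurableSet]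
    exact measure_mono (iUnion₂_subset fun c _ => subset_sUnion_of_mem c.2.1)
  calc volume (φ ∘ g '' Z)
      ≤ ∑' c : 𝒞', volume (φ '' (g '' (S ∩ c))) :=
        (measure_mono hcover).trans (measure_biUnion_le _ h𝒞' _)
    _ ≤ ∑' c : 𝒞', K * Metric.ediam (g '' (S ∩ c)) := ENNReal.tsum_le_tsum fun c =>
        (Real.volume_le_diam _).trans (hφ.ediam_image_le _)
    _ ≤ K * ENNReal.ofReal (ε / (K + 1)) := by
        rw [ENNReal.tsum_mul_left, ENNReal.tsum_eq_iSup_sum]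
        gcongr
        exact iSup_le hsmall
    _ ≤ 0 + ε := by
        rw [zero_add, ← ENNReal.ofReal_coe_nnreal (p := K), ← ENNReal.ofReal_mul K.coe_nonneg,
          ← ENNReal.ofReal_coe_nnreal (p := ε)]
        refine ENNReal.ofReal_le_ofReal ?_
        rw [mul_div_left_comm]
        exact mul_le_of_le_one_right ε.coe_nonneg ((div_le_one (by positivity)).2 (by linarith))

theorem ACGStarOn.lipschitzOnWith {K : ℝ≥0} (hg : ACGStarOn g S) (hS : S.OrdConnected)
    (hd : ∀ᵐ t : ℝ, t ∈ S → ∃ v, ‖v‖ ≤ K ∧ HasDerivAt g v t) : LipschitzOnWith K g S := by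
  refine LipschitzOnWith.of_dist_le_mul fun a ha b hb => ?_
  set w := g a - g b
  obtain ⟨hcont, C, rfl, hC⟩ := hg
  let φ := innerSL ℝ w
  have hφ : LipschitzOnWith (‖w‖₊ * K) (φ ∘ g) (⋃ k, C k) := by
    refine (LusinN.iUnion fun k => (hC k).lusinN_comp φ.lipschitz).lipschitzOnWith hS
      (φ.continuous.comp_continuousOn hcont) ?_
    filter_upwards [hd] with t ht htS
    obtain ⟨v, hv, hvt⟩ := ht htS
    refine ⟨φ v, ?_, φ.hasFDerivAt.comp_hasDerivAt t hvt⟩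
    exact (norm_inner_le_norm w v).trans (mul_le_mul_of_nonneg_left hv (norm_nonneg w))
  have hw : ‖w‖ * ‖w‖ ≤ ‖w‖ * (K * dist a b) := calc
    ‖w‖ * ‖w‖ = φ (g a) - φ (g b) := by
      rw [← map_sub, innerSL_apply_apply, real_inner_self_eq_norm_mul_norm]
    _ ≤ dist (φ (g a)) (φ (g b)) := le_abs_self _
    _ ≤ ‖w‖ * (K * dist a b) := (hφ.dist_le_mul a ha b hb).trans_eq (by simp [mul_assoc])
  rw [dist_eq_norm]
  by_contra! h
  exact hw.not_gt (mul_lt_mul_of_pos_left h (lt_of_le_of_lt (by positivity) h))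

end ACStar

section Gluing

variable {n : ℕ} {x y : ℝ → EuclideanSpace ℝ (Fin n)} {S A I : Set ℝ} {T : ℝ}

lemma ACStarOn.mono (hx : ACStarOn x A) (hSA : S ⊆ A) : ACStarOn x S := fun ε hε =>
  (hx ε hε).imp fun _ ⟨hδ, h⟩ => ⟨hδ, fun m a b hab =>
    h m a b fun i => ⟨(hab i).1, hSA (hab i).2.1, hSA (hab i).2.2⟩⟩

lemma ACStarOn.congr (hx : ACStarOn x S) (hA : A.OrdConnected) (hSA : S ⊆ A) (hxy : EqOn x y A) :
    ACStarOn y S := fun ε hε =>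
  (hx ε hε).imp fun _ ⟨hδ, h⟩ => ⟨hδ, fun m a b hab hdisj hlen => by
    refine lt_of_eq_of_lt (Finset.sum_congr rfl fun i _ => ?_) (h m a b hab hdisj hlen)
    rw [(hxy.mono (hA.out (hSA (hab i).2.1) (hSA (hab i).2.2))).image_eq]⟩

lemma ACGStarOn.mono (hx : ACGStarOn x A) (hSA : S ⊆ A) : ACGStarOn x S := by
  obtain ⟨hcont, C, rfl, hC⟩ := hx
  exact ⟨hcont.mono hSA, fun k => S ∩ C k, by rw [← inter_iUnion, inter_eq_left.2 hSA],
    fun k => (hC k).mono inter_subset_right⟩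

lemma acStarOn_of_absolutelyContinuousOnInterval {a b : ℝ}
    (hx : AbsolutelyContinuousOnInterval x a b) : ACStarOn x (uIcc a b) := by
  rw [absolutelyContinuousOnInterval_iff] at hx
  intro ε hε
  obtain ⟨δ, hδ, hxδ⟩ := hx (ε / 2) (half_pos hε)
  refine ⟨δ, hδ, fun m c d hcd hdisj hlen => lt_of_le_of_lt (b := ENNReal.ofReal (ε / 2)) ?_
    ((ENNReal.ofReal_lt_ofReal_iff hε).2 (half_lt_self hε))⟩
  refine sum_ediam_image_le (fun i => nonempty_Icc.2 (hcd i).1) fun p q hp hq => ?_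
  let E (k : ℕ) : ℝ × ℝ := if hk : k < m then (p ⟨k, hk⟩, q ⟨k, hk⟩) else 0
  have hE (i : Fin m) : E i = (p i, q i) := by simp [E]
  have hsum : ∑ k ∈ Finset.range m, dist (x (E k).1) (x (E k).2) < ε / 2 := by
    refine hxδ (m, E) ⟨fun k hk => ?_, fun k hk l hl hkl => ?_⟩ ?_
    · lift k to Fin m using Finset.mem_range.1 hk
      have hsub := ordConnected_uIcc.out (hcd k).2.1 (hcd k).2.2
      simp only [hE]
      exact ⟨hsub (hp k), hsub (hq k)⟩
    · lift k to Fin m using Finset.mem_range.1 hk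
      lift l to Fin m using Finset.mem_range.1 hl
      simp only [Function.onFun, hE]
      exact (hdisj (Fin.val_injective.ne_iff.1 hkl)).mono
        (Ioc_subset_Ioc (le_inf (hp k).1 (hq k).1) (sup_le (hp k).2 (hq k).2))
        (Ioc_subset_Ioc (le_inf (hp l).1 (hq l).1) (sup_le (hp l).2 (hq l).2))
    · simp only [Finset.sum_range, hE]
      exact (Finset.sum_le_sum fun i _ => Real.dist_le_of_mem_Icc (hp i) (hq i)).trans_lt hlen
  simp only [Finset.sum_range, hE] at hsum
  simp only [edist_dist]
  rw [← ENNReal.ofReal_sum_of_nonneg fun i _ => dist_nonneg]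
  exact ENNReal.ofReal_le_ofReal hsum.le

lemma acgStarOn_iUnion {ι : Type*} [Countable ι] [Nonempty ι] {C : ι → Set ℝ}
    (hcont : ContinuousOn x (⋃ i, C i)) (hC : ∀ i, ACStarOn x (C i)) : ACGStarOn x (⋃ i, C i) :=
  have ⟨e, he⟩ := exists_surjective_nat ι
  ⟨hcont, C ∘ e, (he.iUnion_comp C).symm, fun k => hC (e k)⟩

theorem ACGStarOn.piecewise_Iio (hI : I.OrdConnected) (hx : ACGStarOn x (I ∩ Iio T))
    (hy : ACGStarOn y (I ∩ Ici T)) (hlim : Tendsto x (𝓝[I ∩ Iio T] T) (𝓝 (y T))) :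
    ACGStarOn ((Iio T).piecewise x y) I := by
  set z := (Iio T).piecewise x y
  have hcont : ContinuousOn z I := by
    refine ContinuousOn.piecewise' (fun t ht => ?_) (fun t ht => ?_) hx.1
      (by simpa only [compl_Iio] using hy.1)
    · obtain rfl : t = T := by simpa using ht.2
      simpa using hlim
    · obtain rfl : t = T := by simpa using ht.2
      simpa [ContinuousWithinAt] using hy.1 t ⟨ht.1, self_mem_Ici⟩
  obtain ⟨-, C, hC, hxC⟩ := hx
  obtain ⟨-, C', hC', hyC'⟩ := hy
  have hcover : I = ⋃ k, Sum.elim C C' k := by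
    rw [iUnion_sumElim, ← hC, ← hC', ← inter_union_distrib_left, Iio_union_Ici, inter_univ]
  have hpieces (k : ℕ ⊕ ℕ) : ACStarOn z (Sum.elim C C' k) := by
    cases k with
    | inl k =>
      exact (hxC k).congr (hI.inter ordConnected_Iio) (hC ▸ subset_iUnion C k)
        (((Iio T).piecewise_eqOn x y).symm.mono inter_subset_right)
    | inr k =>
      exact (hyC' k).congr (hI.inter ordConnected_Ici) (hC' ▸ subset_iUnion C' k)
        (((Iio T).piecewise_eqOn_compl x y).symm.mono fun t ht => notMem_Iio.2 ht.2)
  rw [hcover] at hcont ⊢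
  exact acgStarOn_iUnion hcont hpieces

end Gluing

section TimeInterval

variable {I : Set ℝ} {a b p t T : ℝ}

lemma isTimeInterval_Icc_iff : IsTimeInterval (Icc a b) ↔ 0 ≤ a ∧ a < b := by
  refine ⟨fun ⟨h0, _, hvol⟩ => ?_, fun ⟨ha, hab⟩ =>
    ⟨fun t ht => ha.trans ht.1, isConnected_Icc hab.le, by simpa⟩⟩
  have hab : a < b := by simpa using hvol
  exact ⟨h0 (left_mem_Icc.2 hab.le), hab⟩

lemma isTimeInterval_Ico_iff : IsTimeInterval (Ico a b) ↔ 0 ≤ a ∧ a < b := by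
  refine ⟨fun ⟨h0, _, hvol⟩ => ?_, fun ⟨ha, hab⟩ =>
    ⟨fun t ht => ha.trans ht.1, isConnected_Ico hab, by simpa⟩⟩
  have hab : a < b := by simpa using hvol
  exact ⟨h0 (left_mem_Ico.2 hab), hab⟩

lemma isTimeInterval_Ici (ha : 0 ≤ a) : IsTimeInterval (Ici a) :=
  ⟨Ici_subset_Ici.2 ha, isConnected_Ici, by simp⟩

lemma IsTimeInterval.ordConnected (hI : IsTimeInterval I) : I.OrdConnected :=
  hI.2.1.isPreconnected.ordConnected

lemma coe_le_supTime (ht : t ∈ I) : (t : EReal) ≤ supTime I :=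
  le_sSup (mem_image_of_mem _ ht)

lemma coe_lt_supTime_iff : (t : EReal) < supTime I ↔ ∃ s ∈ I, t < s := by
  simp [supTime, lt_sSup_iff]

lemma supTime_Ico (hab : a < b) : supTime (Ico a b) = b := by
  rw [supTime, ← Monotone.map_csSup_of_continuousAt continuous_coe_real_ereal.continuousAt
    EReal.coe_strictMono.monotone (nonempty_Ico.2 hab) bddAbove_Ico, csSup_Ico hab]

lemma supTime_Ici (a : ℝ) : supTime (Ici a) = ⊤ :=
  EReal.eq_top_iff_forall_lt _ |>.2 fun t =>
    coe_lt_supTime_iff.2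
      ⟨max a (t + 1), mem_Ici.2 (le_max_left _ _), lt_max_of_lt_right (lt_add_one t)⟩

lemma IsTimeInterval.mem_of_le_of_coe_lt_supTime (hI : IsTimeInterval I) (hp : p ∈ I)
    (hpt : p ≤ t) (ht : (t : EReal) < supTime I) : t ∈ I :=
  have ⟨_, hs, hts⟩ := coe_lt_supTime_iff.1 ht
  hI.ordConnected.out hp hs ⟨hpt, hts.le⟩

lemma IsTimeInterval.mem_nhdsLT (hI : IsTimeInterval I) (hT : supTime I = T) : I ∈ 𝓝[<] T := by
  obtain ⟨a, ha, haT⟩ : ∃ a ∈ I, a < T := by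
    by_contra! h
    refine hI.2.2 (measure_mono_null (fun t ht => ?_) (measure_singleton T))
    exact le_antisymm (EReal.coe_le_coe_iff.1 (hT ▸ coe_le_supTime ht)) (h t ht)
  exact mem_of_superset (Ico_mem_nhdsLT haT) fun t ht =>
    hI.mem_of_le_of_coe_lt_supTime ha ht.1 (hT ▸ EReal.coe_lt_coe ht.2)

lemma IsTimeInterval.mem_atTop (hI : IsTimeInterval I) (hT : supTime I = ⊤) : I ∈ atTop := by
  obtain ⟨a, ha⟩ := hI.2.1.nonempty
  exact mem_atTop_sets.2 ⟨a, fun t hat => hI.mem_of_le_of_coe_lt_supTime ha hat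
    (hT ▸ EReal.coe_lt_top t)⟩

lemma comap_toEReal_nhds_top : comap Real.toEReal (𝓝 ⊤) = atTop := by
  refine EReal.nhds_top_basis.comap _ |>.eq_of_same_basis ?_
  convert atTop_basis_Ioi (α := ℝ) using 1
  simp

end TimeInterval

section Solutions

variable {n : ℕ} {F : EuclideanSpace ℝ (Fin n) → ℝ → Set (EuclideanSpace ℝ (Fin n))}
  {x y : ℝ → EuclideanSpace ℝ (Fin n)} {D I J : Set ℝ} {a b p T T' : ℝ}

lemma SatisfiesInclusionAE.mono (hx : SatisfiesInclusionAE F I x) (hJI : J ⊆ I) :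
    SatisfiesInclusionAE F J x :=
  Eventually.mono hx fun _ ht htJ => ht (hJI htJ)

lemma SatisfiesInclusionAE.piecewise_Iio (hx : SatisfiesInclusionAE F (I ∩ Iio T) x)
    (hy : SatisfiesInclusionAE F (I ∩ Ici T) y) :
    SatisfiesInclusionAE F I ((Iio T).piecewise x y) := by
  filter_upwards [hx, hy, Measure.ae_ne volume T] with t hxt hyt htT htI
  rcases htT.lt_or_gt with h | h
  · obtain ⟨v, hv, hvt⟩ := hxt ⟨htI, h⟩
    rw [piecewise_eq_of_mem (Iio T) _ _ h]
    exact ⟨v, hv, hvt.congr_of_eventuallyEq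
      (eventuallyEq_of_mem (Iio_mem_nhds h) ((Iio T).piecewise_eqOn x y))⟩
  · obtain ⟨v, hv, hvt⟩ := hyt ⟨htI, h.le⟩
    rw [piecewise_eq_of_notMem _ _ _ (notMem_Iio.2 h.le)]
    exact ⟨v, hv, hvt.congr_of_eventuallyEq
      (eventuallyEq_of_mem (Ioi_mem_nhds h) fun s hs =>
        piecewise_eq_of_notMem _ _ _ (notMem_Iio.2 (mem_Ioi.1 hs).le))⟩

lemma IsGeneralizedSolution.mono (hx : IsGeneralizedSolution F I x) (hJ : IsTimeInterval J)
    (hJI : J ⊆ I) : IsGeneralizedSolution F J x :=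
  ⟨hJ, hx.2.1.mono hJI, hx.2.2.mono hJI⟩

lemma IsGeneralizedSolution.piecewise_Iio (hx : IsGeneralizedSolution F (Ico p T) x)
    (hy : IsGeneralizedSolution F (Icc T T') y) (hlim : Tendsto x (𝓝[<] T) (𝓝 (y T))) :
    IsGeneralizedSolution F (Icc p T') ((Iio T).piecewise x y) := by
  obtain ⟨hp, hpT⟩ := isTimeInterval_Ico_iff.1 hx.1
  obtain ⟨-, hTT'⟩ := isTimeInterval_Icc_iff.1 hy.1
  have hleft : Icc p T' ∩ Iio T = Ico p T := by grind
  have hright : Icc p T' ∩ Ici T = Icc T T' := by grind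
  refine ⟨isTimeInterval_Icc_iff.2 ⟨hp, hpT.trans hTT'⟩,
    ACGStarOn.piecewise_Iio ordConnected_Icc ?_ ?_ (hlim.mono_left ?_),
    SatisfiesInclusionAE.piecewise_Iio ?_ ?_⟩
  · exact hleft ▸ hx.2.1
  · exact hright ▸ hy.2.1
  · exact nhdsWithin_mono T inter_subset_right
  · exact hleft ▸ hx.2.2
  · exact hright ▸ hy.2.2

lemma IsClassicalSolution.mono (hx : IsClassicalSolution F I x) (hJ : IsTimeInterval J)
    (hJI : J ⊆ I) : IsClassicalSolution F J x :=
  ⟨hJ, fun a b hab habJ => hx.2.1 a b hab (habJ.trans hJI), hx.2.2.mono hJI⟩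

lemma IsClassicalSolution.isGeneralizedSolution_Icc (hx : IsClassicalSolution F (Icc a b) x) :
    IsGeneralizedSolution F (Icc a b) x := by
  obtain ⟨hI, hac, hinc⟩ := hx
  have hab := (isTimeInterval_Icc_iff.1 hI).2.le
  have hac' := hac a b hab Subset.rfl
  rw [← uIcc_of_le hab] at hI hinc ⊢
  refine ⟨hI, ?_, hinc⟩
  rw [← iUnion_const (ι := Unit) (uIcc a b)]
  exact acgStarOn_iUnion (by simpa only [iUnion_const] using hac'.continuousOn)
    fun _ => acStarOn_of_absolutelyContinuousOnInterval hac'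

lemma isClassicalSolution_zero (h0 : ∀ᵐ t : ℝ, 0 ≤ t → (0 : EuclideanSpace ℝ (Fin n)) ∈ F 0 t)
    (hI : IsTimeInterval I) : IsClassicalSolution F I 0 :=
  ⟨hI, fun _ _ _ _ => (LipschitzWith.const 0).lipschitzOnWith.absolutelyContinuousOnInterval,
    h0.mono fun t ht htI => ⟨0, ht (hI.1 htI), hasDerivAt_const t 0⟩⟩

lemma LocallyBoundedOff.isBounded_biUnion {K : Set ℝ} (hF : LocallyBoundedOff F D)
    (hK : IsCompact K) (hKD : K ⊆ Ici 0 \ D) (hx : ContinuousOn x K) :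
    Bornology.IsBounded (⋃ t ∈ K, F (x t) t) := by
  refine hK.induction_on (p := fun S => Bornology.IsBounded (⋃ t ∈ S, F (x t) t)) (by simp)
    (fun S S' hSS' hS' => hS'.subset (biUnion_subset_biUnion_left hSS'))
    (fun S S' hS hS' => by rw [biUnion_union]; exact hS.union hS') fun t ht => ?_
  obtain ⟨Q, hQ⟩ := hF (x t) t (hKD ht)
  have hgraph : Tendsto (fun s => (x s, s)) (𝓝[K] t) (𝓝[univ ×ˢ (Ici 0 \ D)] (x t, t)) :=
    tendsto_nhdsWithin_iff.2 ⟨(hx t ht).prodMk_nhds nhdsWithin_le_nhds,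
      eventually_mem_nhdsWithin.mono fun s hs => ⟨mem_univ _, hKD hs⟩⟩
  exact ⟨_, hgraph.eventually hQ, isBounded_iff_forall_norm_le.2
    ⟨Q, by simpa only [mem_iUnion₂] using fun v ⟨_, hs, hv⟩ => hs v hv⟩⟩

theorem IsGeneralizedSolution.isClassicalSolution (hx : IsGeneralizedSolution F I x)
    (hF : LocallyBoundedOff F D) (hID : Disjoint I D) : IsClassicalSolution F I x := by
  obtain ⟨hI, hacg, hinc⟩ := hx
  refine ⟨hI, fun a b hab habI => ?_, hinc⟩
  have hbdd := hF.isBounded_biUnion isCompact_Icc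
    (fun t ht => ⟨hI.1 (habI ht), disjoint_left.1 hID (habI ht)⟩) (hacg.1.mono habI)
  obtain ⟨K, hK, hFK⟩ := hbdd.exists_pos_norm_le
  lift K to NNReal using hK.le
  refine LipschitzOnWith.absolutelyContinuousOnInterval (K := K) ?_
  rw [uIcc_of_le hab]
  refine (hacg.mono habI).lipschitzOnWith ordConnected_Icc ?_
  filter_upwards [hinc] with t ht htab
  obtain ⟨v, hv, hvt⟩ := ht (habI htab)
  exact ⟨v, hFK v (mem_biUnion htab hv), hvt⟩

end Solutions

section Continuation

variable {n : ℕ} {F : EuclideanSpace ℝ (Fin n) → ℝ → Set (EuclideanSpace ℝ (Fin n))}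
  {x y : ℝ → EuclideanSpace ℝ (Fin n)} {D I : Set ℝ} {a p t T T' : ℝ}

lemma LocallyACOn.continuousAt (hx : LocallyACOn x I) (ht : I ∈ 𝓝 t) : ContinuousAt x t := by
  obtain ⟨a, b, htab, hab, habI⟩ := exists_Icc_mem_subset_of_mem_nhds ht
  have hle : a ≤ b := htab.1.trans htab.2
  exact (uIcc_of_le hle ▸ (hx a b hle habI).continuousOn).continuousAt hab

theorem IsMaximalSolution.not_tendsto_of_isGeneralizedSolution
    (hx : IsMaximalSolution (IsGeneralizedSolution F) I x) (hT : supTime I = T)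
    (hy : IsGeneralizedSolution F (Icc T T') y) : ¬ Tendsto x (𝓝[<] T) (𝓝 (y T)) := by
  intro hlim
  obtain ⟨hxI, hmax⟩ := hx
  have hTT' := (isTimeInterval_Icc_iff.1 hy.1).2
  have hI : I ∈ 𝓝[<] T := hxI.1.mem_nhdsLT hT
  obtain ⟨p, hpT : p < T, hpI⟩ := mem_nhdsLT_iff_exists_Ico_subset.1 hI
  have hp : p ∈ Ico p T := left_mem_Ico.2 hpT
  have hxp : IsGeneralizedSolution F (Ico p T) x :=
    hxI.mono (isTimeInterval_Ico_iff.2 ⟨hxI.1.1 (hpI hp), hpT⟩) hpI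
  refine hmax ⟨Icc p T', (Iio T).piecewise x y, hxp.piecewise_Iio hy hlim,
    ⟨p, left_mem_Icc.2 (hpT.trans hTT').le, hpI hp⟩, ?_, fun t ⟨htI, _⟩ => ?_⟩
  · exact hT ▸ coe_lt_supTime_iff.2 ⟨T', right_mem_Icc.2 (hpT.trans hTT').le, hTT'⟩
  · have htT : t ≤ T := EReal.coe_le_coe_iff.1 (hT ▸ coe_le_supTime htI)
    rcases htT.lt_or_eq with h | rfl
    · rw [piecewise_eq_of_mem (Iio T) _ _ h]
    · rw [piecewise_eq_of_notMem _ _ _ self_notMem_Iio]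
      exact tendsto_nhds_unique ((hxI.2.1.1 t htI).mono_left (nhdsWithin_le_of_mem hI)) hlim

theorem IsClassicallyAttractive.exists_isClassicalSolution_Icc (hattr : IsClassicallyAttractive F)
    (hx : IsClassicalSolution F (Ico p T) x) :
    ∃ T' y, IsClassicalSolution F (Icc T T') y ∧ Tendsto x (𝓝[<] T) (𝓝 (y T)) := by
  obtain ⟨hp, hpT⟩ := isTimeInterval_Ico_iff.1 hx.1
  by_cases hmax : IsMaximalSolution (IsClassicalSolution F) (Ico p T) x
  · refine ⟨T + 1, 0, isClassicalSolution_zero hattr.1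
      (isTimeInterval_Icc_iff.2 ⟨hp.trans hpT.le, lt_add_one T⟩), ?_⟩
    have hlim := hattr.2 _ _ hmax
    rwa [supTime_Ico hpT, ← EReal.isEmbedding_coe.nhds_eq_comap, ← nhdsWithin,
      nhdsWithin_Ico_eq_nhdsLT hpT] at hlim
  · obtain ⟨J, y, hy, ⟨r, hrJ, hr⟩, hsup, hxy⟩ := not_not.1 fun h => hmax ⟨hx, h⟩
    obtain ⟨T', hT'J, hTT'⟩ := coe_lt_supTime_iff.1 (supTime_Ico hpT ▸ hsup)
    have hrT' : Icc r T' ⊆ J := hy.1.ordConnected.out hrJ hT'J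
    refine ⟨T', y, hy.mono (isTimeInterval_Icc_iff.2 ⟨hp.trans hpT.le, hTT'⟩)
      ((Icc_subset_Icc_left hr.2.le).trans hrT'), ?_⟩
    have hyT : ContinuousAt y T :=
      hy.2.1.continuousAt (mem_of_superset (Icc_mem_nhds hr.2 hTT') hrT')
    refine (hyT.tendsto.mono_left nhdsWithin_le_nhds).congr' ?_
    filter_upwards [Ico_mem_nhdsLT hr.2] with t ht
    exact (hxy t ⟨⟨hr.1.trans ht.1, ht.2⟩, hrT' ⟨ht.1, (ht.2.trans hTT').le⟩⟩).symm

theorem IsMaximalSolution.supTime_eq_top (hx : IsMaximalSolution (IsGeneralizedSolution F) I x)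
    (hD : ∀ T, ∀ᶠ t in 𝓝[<] T, t ∉ D) (hF : LocallyBoundedOff F D)
    (hattr : IsClassicallyAttractive F) : supTime I = ⊤ := by
  obtain ⟨t, ht⟩ := hx.1.1.2.1.nonempty
  by_contra htop
  lift supTime I to ℝ using ⟨htop, ((EReal.bot_lt_coe t).trans_le (coe_le_supTime ht)).ne'⟩
    with T hT
  obtain ⟨p, hpT, hp⟩ := mem_nhdsLT_iff_exists_Ico_subset.1
    ((hD T).and (hx.1.1.mem_nhdsLT hT.symm))
  have hxp : IsClassicalSolution F (Ico p T) x :=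
    (hx.1.mono (isTimeInterval_Ico_iff.2 ⟨hx.1.1.1 (hp (left_mem_Ico.2 hpT)).2, hpT⟩)
      fun t ht => (hp ht).2).isClassicalSolution hF (disjoint_left.2 fun t ht => (hp ht).1)
  obtain ⟨T', y, hy, hlim⟩ := hattr.exists_isClassicalSolution_Icc hxp
  exact hx.not_tendsto_of_isGeneralizedSolution hT.symm hy.isGeneralizedSolution_Icc hlim

lemma IsClassicallyAttractive.tendsto_atTop (hattr : IsClassicallyAttractive F)
    (hx : IsClassicalSolution F (Ici a) x) : Tendsto x atTop (𝓝 0) := by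
  have hmax : IsMaximalSolution (IsClassicalSolution F) (Ici a) x :=
    ⟨hx, fun ⟨J, y, _, _, hsup, _⟩ => not_top_lt (supTime_Ici a ▸ hsup)⟩
  have hlim := hattr.2 _ _ hmax
  rwa [supTime_Ici, comap_toEReal_nhds_top, inf_eq_left.2 (le_principal_iff.2 (Ici_mem_atTop a))]
    at hlim

lemma IsGeneralizedSolution.exists_isClassicalSolution_Ici (hx : IsGeneralizedSolution F I x)
    (hI : supTime I = ⊤) (hF : LocallyBoundedOff F D) (hD : BddAbove D) :
    ∃ a, IsClassicalSolution F (Ici a) x := by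
  obtain ⟨B, hB⟩ := hD
  obtain ⟨a, ha⟩ := mem_atTop_sets.1 (inter_mem (hx.1.mem_atTop hI) (Ioi_mem_atTop B))
  exact ⟨a, (hx.mono (isTimeInterval_Ici (hx.1.1 (ha a le_rfl).1)) fun t ht => (ha t ht).1)
    |>.isClassicalSolution hF (disjoint_left.2 fun t ht htD => (hB htD).not_gt (ha t ht).2)⟩

end Continuation

theorem mainTheorem1_general {n : ℕ}
    {F : EuclideanSpace ℝ (Fin n) → ℝ → Set (EuclideanSpace ℝ (Fin n))} {D : Set ℝ}
    (hD : ∀ T, ∀ᶠ t in 𝓝[<] T, t ∉ D) (hF : LocallyBoundedOff F D)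
    (hattr : IsClassicallyAttractive F) :
    (∀ (I : Set ℝ) (x : ℝ → EuclideanSpace ℝ (Fin n)),
      IsMaximalSolution (IsGeneralizedSolution F) I x → supTime I = ⊤) ∧
    (BddAbove D → IsGeneralizedAttractive F) := by
  refine ⟨fun I x hx => hx.supTime_eq_top hD hF hattr, fun hDbdd => ⟨hattr.1, fun I x hx => ?_⟩⟩
  have htop := hx.supTime_eq_top hD hF hattr
  obtain ⟨a, ha⟩ := hx.1.exists_isClassicalSolution_Ici htop hF hDbdd
  rw [htop, comap_toEReal_nhds_top]
  exact (hattr.tendsto_atTop ha).mono_left inf_le_left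

theorem mainTheorem1 {n : ℕ}
    (F : EuclideanSpace ℝ (Fin n) → ℝ → Set (EuclideanSpace ℝ (Fin n)))
    (D : Set ℝ) (hD : D ⊆ Set.Ici 0)
    (hcluster : ∀ t : ℝ, ¬ AccPt t (Filter.principal D))
    (hF : LocallyBoundedOff F D)
    (hattr : IsClassicallyAttractive F) :
    (∀ (I : Set ℝ) (x : ℝ → EuclideanSpace ℝ (Fin n)),
      IsMaximalSolution (IsGeneralizedSolution F) I x → supTime I = ⊤) ∧
    (BddAbove D → IsGeneralizedAttractive F) :=
  mainTheorem1_general (fun T => (not_frequently.1 fun h =>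
    hcluster T (accPt_iff_frequently_nhdsNE.2 h)).filter_mono (nhdsLT_le_nhdsNE T)) hF hattr
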